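/- A quotient Borel space is a pair $(X,E)$, where $X$ is a standard Borel space and $E$ is an equivalence relation on $X$ that is Borel as a subset of $X\times X$ and all of whose equivalence classes are countable; its underlying set is $X/E$. A subset $A\subseteq X/E$ is Borel in $(X,E)$ if its preimage under the quotient projection $X\to X/E$ is Borel in $X$. The product $(X,E)\times(Y,F)$ is the quotient Borel space $(X\times Y,E\times F)$, where $(x_1,y_1)\mathrel{(E\times F)}(x_2,y_2)$ if and only if $x_1\mathrel{E}x_2$ and $y_1\mathrel{F}y_2$, and its underlying set is identified with $X/E\times Y/F$. A Borel relation $R\subseteq(X,E)\times(Y,F)$ is a Borel subset of this product, and a function $f:X/E\to Y/F$ is a Borel function $(X,E)\to(Y,F)$ if its graph is a Borel relation. Let $(X,E)$ and $(Y,F)$ be quotient Borel spaces, let $R\subseteq(X,E)\times(Y,F)$ be a Borel relation, and let $f:(X,E)\to(Y,F)$ be a Borel function. 1. If for every $x\in X/E$ the section $R_x=\{y\in Y/F : (x,y)\in R\}$ is countable, then the domain $\operatorname{dom}R=\{x\in X/E : \exists y\in Y/F,\ (x,y)\in R\}$ is Borel in $(X,E)$. 2. For every Borel subset $B\subseteq(Y,F)$,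 the preimage $f^{-1}[B]$ is Borel in $(X,E)$. 3. If $f$ is countable-to-one, that is, $f^{-1}[\{y\}]$ is countable for every $y\in Y/F$, then for every Borel subset $A\subseteq(X,E)$ the image $f[A]$ is Borel in $(Y,F)$. -/

import Mathlib

/-- A quotient Borel space `(X, E)`: a countable Borel equivalence relation `E` on the standard
Borel space `X`. -/
structure QuotientBorelSpace (X : Type*) [MeasurableSpace X] [StandardBorelSpace X] where
  /-- The equivalence relation `E`. -/
  rel : Setoid X
  /-- `E` is Borel as a subset of `X × X`. -/
  measurableSet_rel : MeasurableSet {p : X × X | rel p.1 p.2}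
  /-- The equivalence classes of `E` are countable. -/
  countable_class : ∀ x, {y | rel x y}.Countable

namespace QuotientBorelSpace

variable {X Y : Type*} [MeasurableSpace X] [StandardBorelSpace X]
  [MeasurableSpace Y] [StandardBorelSpace Y]

/-- The underlying set `X / E` of `(X, E)`. -/
def Points (P : QuotientBorelSpace X) : Type _ := Quotient P.rel

/-- The quotient projection `X → X / E`. -/
def proj (P : QuotientBorelSpace X) (x : X) : P.Points := Quotient.mk P.rel x

/-- A subset of `(X, E)` is Borel if its preimage under the quotient projection is Borel in `X`. -/
def IsBorel (P : QuotientBorelSpace X) (A : Set P.Points) : Prop :=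
  MeasurableSet (P.proj ⁻¹' A)

/-- The product `(X, E) × (Y, F) = (X × Y, E × F)`. -/
def prod (P : QuotientBorelSpace X) (Q : QuotientBorelSpace Y) : QuotientBorelSpace (X × Y) where
  rel := P.rel.prod Q.rel
  measurableSet_rel := by
    have h1 : Measurable fun p : (X × Y) × (X × Y) => (p.1.1, p.2.1) := by fun_prop
    have h2 : Measurable fun p : (X × Y) × (X × Y) => (p.1.2, p.2.2) := by fun_prop
    exact (h1 P.measurableSet_rel).inter (h2 Q.measurableSet_rel)
  countable_class := fun x => (P.countable_class x.1).prod (Q.countable_class x.2)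

/-- The natural identification of the underlying set of `(X, E) × (Y, F)` with the product of the
underlying sets of `(X, E)` and `(Y, F)`. -/
def prodPoints (P : QuotientBorelSpace X) (Q : QuotientBorelSpace Y) :
    P.Points × Q.Points ≃ (P.prod Q).Points :=
  Setoid.prodQuotientEquiv P.rel Q.rel

/-- A relation between `(X, E)` and `(Y, F)` is Borel if it is a Borel subset of the product
`(X × Y, E × F)`. -/
def IsBorelRel (P : QuotientBorelSpace X) (Q : QuotientBorelSpace Y)
    (R : Set (P.Points × Q.Points)) : Prop :=
  (P.prod Q).IsBorel (P.prodPoints Q '' R)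

/-- A function `(X, E) → (Y, F)` is Borel if its graph is a Borel relation. -/
def IsBorelFun (P : QuotientBorelSpace X) (Q : QuotientBorelSpace Y)
    (f : P.Points → Q.Points) : Prop :=
  P.IsBorelRel Q {p | f p.1 = p.2}

end QuotientBorelSpace

namespace MeasureTheory

open Set Filter Topology TopologicalSpace

/-! All three claims reduce to the Lusin–Novikov theorem: a Borel set with countable sections has
Borel projection. Classes are countable, so countable sections in `Y/F` lift to countable sections
in `Y`; preimages and images under `f` are domains of restricted graphs. Lusin–Novikov follows from
`measurableSet_range_of_continuous_of_countable_fibers`. If the range is not Borel,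
`exists_split_of_not_isBorelCoveredIn` builds a Cantor scheme whose `2^n` sets at level `n` have
images with a common point; the limits along all branches are distinct and lie in one fiber, which
is then uncountable. -/

/-- **Novikov's separation theorem** for finite families: analytic sets with empty intersection are
contained in Borel sets with empty intersection. -/
theorem AnalyticSet.exists_measurableSet_superset_iInter_eq_empty {X ι : Type*}
    [TopologicalSpace X] [PolishSpace X] [MeasurableSpace X] [BorelSpace X]
    (s : Finset ι) : ∀ (A : ι → Set X) (C : Set X), (∀ i, AnalyticSet (A i)) → AnalyticSet C →
    C ∩ ⋂ i ∈ s, A i = ∅ →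
    ∃ W : ι → Set X, (∀ i, MeasurableSet (W i)) ∧ (∀ i, A i ⊆ W i) ∧ C ∩ ⋂ i ∈ s, W i = ∅ := by
  classical
  induction s using Finset.induction_on with
  | empty =>
    intro A C _ _ h
    refine ⟨fun _ => univ, fun _ => .univ, fun _ => subset_univ _, by simpa using h⟩
  | insert a s ha ih =>
    intro A C hA hC h
    have hCA : AnalyticSet (C ∩ A a) := by
      rw [inter_eq_iInter]
      exact AnalyticSet.iInter fun b => by cases b <;> simp [hC, hA]
    -- `C` absorbs `A a`; the latter is then separated from `C ∩ I` by Lusin's theorem.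
    obtain ⟨W, hWm, hAW, hW⟩ := ih A (C ∩ A a) hA hCA (by
      rw [← h, Finset.set_biInter_insert, inter_assoc])
    set I : Set X := ⋂ i ∈ s, W i with hI
    have hIm : MeasurableSet I := Finset.measurableSet_biInter _ fun i _ => hWm i
    have hCI : AnalyticSet (C ∩ I) := by
      rw [inter_eq_iInter]
      exact AnalyticSet.iInter fun b => by cases b <;> simp [hC, hIm.analyticSet]
    obtain ⟨V, hAV, hV, hVm⟩ := (hA a).measurablySeparable hCI (by
      rw [Set.disjoint_iff_inter_eq_empty, ← hW]; ac_rfl)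
    refine ⟨Function.update W a V, fun i => ?_, fun i => ?_, ?_⟩
    · by_cases hi : i = a
      · subst hi; simpa using hVm
      · simpa [hi] using hWm i
    · by_cases hi : i = a
      · subst hi; simpa using hAV
      · simpa [hi] using hAW i
    · have : ⋂ i ∈ s, Function.update W a V i = I :=
        iInter₂_congr fun i hi => by
          rw [Function.update_of_ne (by rintro rfl; exact ha hi)]
      rw [Finset.set_biInter_insert, this, Function.update_self]
      rw [Set.disjoint_iff_inter_eq_empty] at hV
      rw [← hV]; ac_rfl

/-! ### Continuous countable-to-one images -/

/-- `IsBorelCoveredIn T C` says that `C` is covered by a Borel subset of `T`. -/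
def IsBorelCoveredIn {X : Type*} [MeasurableSpace X] (T C : Set X) : Prop :=
  ∃ D, MeasurableSet D ∧ C ⊆ D ∧ D ⊆ T

/-- If the common part of the images `f '' U i` of finitely many open sets is not covered by a Borel
subset of the range of `f`, then each `U i` can be split into two small disjoint open sets without
losing this property. -/
theorem exists_split_of_not_isBorelCoveredIn {X Z ι : Type*} [Finite ι]
    [TopologicalSpace X] [PolishSpace X] [MeasurableSpace X] [BorelSpace X]
    [MetricSpace Z] [CompleteSpace Z] [SecondCountableTopology Z]
    {f : Z → X} (hf : Continuous f) {U : ι → Set Z} (hU : ∀ i, IsOpen (U i))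
    (hbad : ¬ IsBorelCoveredIn (range f) (⋂ i, f '' U i)) [Nonempty ι] {ε : ℝ} (hε : 0 < ε) :
    ∃ V : ι × Bool → Set Z, (∀ p, IsOpen (V p)) ∧ (∀ p, closure (V p) ⊆ U p.1) ∧
      (∀ i, Disjoint (V (i, false)) (V (i, true))) ∧
      (∀ p, ∀ a ∈ V p, ∀ b ∈ V p, dist a b ≤ ε) ∧
      ¬ IsBorelCoveredIn (range f) (⋂ p, f '' V p) := by
  classical
  by_contra! hV
  apply hbad
  borelize Z
  have := Fintype.ofFinite ι
  -- Only basic open sets are used, so that there are countably many splittings and `D` is Borel.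
  let 𝒱 : Set (ι × Bool → countableBasis Z) := {V |
    (∀ p, closure (V p : Set Z) ⊆ U p.1) ∧
      (∀ i, Disjoint (V (i, false) : Set Z) (V (i, true))) ∧
      (∀ p, ∀ a ∈ (V p : Set Z), ∀ b ∈ (V p : Set Z), dist a b ≤ ε)}
  have hcov : ∀ V : 𝒱, IsBorelCoveredIn (range f) (⋂ p, f '' (V.1 p : Set Z)) := fun V =>
    hV (fun p => V.1 p) (fun p => isOpen_of_mem_countableBasis (V.1 p).2) V.2.1 V.2.2.1 V.2.2.2
  choose E hEm hEs hEr using hcov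
  set D : Set X := ⋃ V, E V with hD
  have hDm : MeasurableSet D := .iUnion hEm
  have hDr : D ⊆ range f := iUnion_subset hEr
  -- Points outside `D` with two preimages in `U i`. A point common to all `A i` would yield a
  -- splitting in `𝒱`, hence lie in `D`.
  let A : ι → Set X := fun i =>
    (fun p : Z × Z => f p.1) ''
      {p | p.1 ∈ U i ∧ p.2 ∈ U i ∧ p.1 ≠ p.2 ∧ f p.1 = f p.2 ∧ f p.1 ∉ D}
  have hA : ∀ i, AnalyticSet (A i) := fun i => by
    have h1 : Measurable fun p : Z × Z => f p.1 := (hf.comp continuous_fst).measurable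
    have h2 : Measurable fun p : Z × Z => f p.2 := (hf.comp continuous_snd).measurable
    refine MeasurableSet.analyticSet_image ?_ h1
    refine (measurable_fst (hU i).measurableSet).inter ((measurable_snd (hU i).measurableSet).inter
      ((measurableSet_eq_fun measurable_fst measurable_snd).compl.inter
        ((measurableSet_eq_fun h1 h2).inter (h1 hDm).compl)))
  have hsmall : ∀ {O : Set Z} {z : Z}, IsOpen O → z ∈ O → ∀ {δ : ℝ}, 0 < δ →
      ∃ B : countableBasis Z, z ∈ (B : Set Z) ∧ closure (B : Set Z) ⊆ O ∧
        (B : Set Z) ⊆ Metric.ball z δ := by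
    intro O z hO hz δ hδ
    obtain ⟨r, hr, hrO⟩ := Metric.nhds_basis_closedBall.mem_iff.1 (hO.mem_nhds hz)
    obtain ⟨B, hB, hzB, hBs⟩ := (isBasis_countableBasis Z).exists_subset_of_mem_open
      (Metric.mem_ball_self (x := z) (lt_min hr hδ)) Metric.isOpen_ball
    refine ⟨⟨B, hB⟩, hzB, ?_, hBs.trans (Metric.ball_subset_ball (min_le_right _ _))⟩
    refine (closure_minimal ?_ Metric.isClosed_closedBall).trans hrO
    exact (hBs.trans (Metric.ball_subset_ball (min_le_left _ _))).trans Metric.ball_subset_closedBall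
  have hAe : univ ∩ ⋂ i ∈ (Finset.univ : Finset ι), A i = ∅ := by
    rw [univ_inter, eq_empty_iff_forall_notMem]
    intro x hx
    have hx' : ∀ i, ∃ z w, z ∈ U i ∧ w ∈ U i ∧ z ≠ w ∧ f z = x ∧ f w = x ∧ x ∉ D := fun i => by
      obtain ⟨⟨z, w⟩, ⟨h1, h2, h3, h4, h5⟩, rfl⟩ := mem_iInter₂.1 hx i (Finset.mem_univ i)
      exact ⟨z, w, h1, h2, h3, rfl, h4.symm, h5⟩
    choose z w hz hw hzw hfz hfw hxD using hx'
    have hδ : ∀ i, 0 < min (ε / 2) (dist (z i) (w i) / 2) := fun i =>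
      lt_min (half_pos hε) (half_pos (dist_pos.2 (hzw i)))
    choose B hBz hBU hBb using fun i => hsmall (hU i) (hz i) (hδ i)
    choose C hCw hCU hCb using fun i => hsmall (hU i) (hw i) (hδ i)
    have hdist : ∀ {S : Set Z} {c : Z} {d : ℝ}, S ⊆ Metric.ball c (min (ε / 2) d) →
        ∀ a ∈ S, ∀ b ∈ S, dist a b ≤ ε := fun {S c d} hS a ha b hb => by
      have h1 := (Metric.mem_ball.1 (hS ha)).trans_le (min_le_left _ _)
      have h2 := (Metric.mem_ball.1 (hS hb)).trans_le (min_le_left _ _)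
      linarith [dist_triangle_right a b c]
    let V : ι × Bool → countableBasis Z := fun p => if p.2 then C p.1 else B p.1
    have hVm : V ∈ 𝒱 := by
      refine ⟨?_, fun i => ?_, ?_⟩
      · rintro ⟨i, b⟩
        cases b
        exacts [hBU i, hCU i]
      · refine Disjoint.mono (hBb i) (hCb i) (Metric.ball_disjoint_ball ?_)
        linarith [min_le_right (ε / 2) (dist (z i) (w i) / 2)]
      · rintro ⟨i, b⟩
        cases b
        exacts [hdist (hBb i), hdist (hCb i)]
    obtain ⟨i⟩ := ‹Nonempty ι›
    refine hxD i (mem_iUnion.2 ⟨⟨V, hVm⟩, hEs _ (mem_iInter.2 ?_)⟩)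
    rintro ⟨j, b⟩
    cases b
    exacts [⟨z j, hBz j, hfz j⟩, ⟨w j, hCw j, hfw j⟩]
  obtain ⟨W, hWm, hAW, hW⟩ := AnalyticSet.exists_measurableSet_superset_iInter_eq_empty
    Finset.univ A univ hA MeasurableSet.univ.analyticSet hAe
  refine ⟨D ∪ ⋃ i, f '' (U i ∩ f ⁻¹' (W i ∪ D)ᶜ), hDm.union (.iUnion fun i => ?_), ?_,
    union_subset hDr (iUnion_subset fun i => image_subset_range _ _)⟩
  -- Off `f ⁻¹' (W i ∪ D)`, `f` is injective on `U i`, so Lusin–Souslin applies.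
  · refine MeasurableSet.image_of_measurable_injOn
      ((hU i).measurableSet.inter (hf.measurable ((hWm i).union hDm).compl)) hf.measurable ?_
    rintro a ⟨haU, ha⟩ b ⟨hbU, -⟩ hab
    by_contra hne
    exact ha (.inl (hAW i ⟨(a, b), ⟨haU, hbU, hne, hab, fun h => ha (.inr h)⟩, rfl⟩))
  · intro x hx
    by_cases hxD : x ∈ D
    · exact .inl hxD
    have : x ∉ ⋂ i ∈ (Finset.univ : Finset ι), W i := fun h =>
      (hW ▸ (⟨mem_univ x, h⟩ : x ∈ univ ∩ ⋂ i ∈ (Finset.univ : Finset ι), W i) : x ∈ (∅ : Set X))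
    simp only [Finset.mem_univ, iInter_true, mem_iInter, not_forall] at this
    obtain ⟨i, hi⟩ := this
    obtain ⟨z, hz, rfl⟩ := mem_iInter.1 hx i
    exact .inr (mem_iUnion.2 ⟨i, z, ⟨hz, fun h => h.elim hi hxD⟩, rfl⟩)

/-- The range of a continuous countable-to-one map between Polish spaces is Borel. -/
theorem measurableSet_range_of_continuous_of_countable_fibers {X Z : Type*}
    [TopologicalSpace X] [PolishSpace X] [MeasurableSpace X] [BorelSpace X]
    [TopologicalSpace Z] [PolishSpace Z] {f : Z → X} (hf : Continuous f)
    (hc : ∀ x, (f ⁻¹' {x}).Countable) : MeasurableSet (range f) := by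
  let := upgradeIsCompletelyMetrizable Z
  by_contra hrange
  let Good : ∀ n, Set ((Fin n → Bool) → Set Z) := fun n => {U | (∀ s, IsOpen (U s)) ∧
    ¬ IsBorelCoveredIn (range f) (⋂ s, f '' U s)}
  have hstep : ∀ n (U : Good n), ∃ V : Good (n + 1),
      (∀ s b, closure (V.1 (Fin.snoc s b)) ⊆ U.1 s) ∧
      (∀ s, Disjoint (V.1 (Fin.snoc s false)) (V.1 (Fin.snoc s true))) ∧
      (∀ s, ∀ a ∈ V.1 s, ∀ b ∈ V.1 s, dist a b ≤ (1 / 2 : ℝ) ^ n) := by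
    rintro n ⟨U, hU, hbad⟩
    obtain ⟨V, hVo, hVU, hVd, hVε, hV⟩ :=
      exists_split_of_not_isBorelCoveredIn hf hU hbad (ε := (1 / 2 : ℝ) ^ n) (by positivity)
    refine ⟨⟨fun s => V (Fin.init s, s (Fin.last n)), fun s => hVo _, ?_⟩, fun s b => ?_,
      fun s => ?_, fun s => hVε _⟩
    · convert hV using 1
      have hs : Function.Surjective
          fun s : Fin (n + 1) → Bool => ((Fin.init s : Fin n → Bool), s (Fin.last n)) :=
        fun ⟨s, b⟩ => ⟨Fin.snoc s b, by simp⟩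
      rw [← hs.iInter_comp]
    · simpa using hVU (s, b)
    · simpa using hVd s
  choose next hnextU hnextd hnextε using hstep
  have h0 : (fun _ => univ) ∈ Good 0 := by
    refine ⟨fun _ => isOpen_univ, ?_⟩
    rintro ⟨D, hDm, hD1, hD2⟩
    refine hrange ?_
    rwa [show range f = D from Subset.antisymm (by rwa [iInter_const, image_univ] at hD1) hD2]
  let U : ∀ n, Good n := fun n => Nat.rec ⟨_, h0⟩ (fun n V => next n V) n
  let res : ∀ n, (ℕ → Bool) → Fin n → Bool := fun n α i => α i
  have hres : ∀ n α, res (n + 1) α = Fin.snoc (res n α) (α n) := fun n α => by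
    funext i
    refine Fin.lastCases ?_ (fun j => ?_) i <;> simp [res]
  have hne : ∀ n, (⋂ s, f '' (U n).1 s).Nonempty := fun n => by
    by_contra h
    refine (U n).2.2 ⟨∅, .empty, ?_, empty_subset _⟩
    rw [not_nonempty_iff_eq_empty.1 h]
  choose x hx using hne
  have hp : ∀ n α, ∃ z ∈ (U n).1 (res n α), f z = x n := fun n α => mem_iInter.1 (hx n) _
  choose p hpU hpx using hp
  have hclos : ∀ n α, closure ((U (n + 1)).1 (res (n + 1) α)) ⊆ (U n).1 (res n α) := fun n α => by
    rw [hres]; exact hnextU n (U n) _ _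
  have hanti : ∀ α, Antitone fun n => (U n).1 (res n α) := fun α =>
    antitone_nat_of_succ_le fun n => subset_closure.trans (hclos n α)
  -- The shift skips level `0`, which is all of `Z`: the bound `(1 / 2) ^ n` holds at level `n + 1`.
  have hcau : ∀ α, CauchySeq fun n => p (n + 1) α := fun α => by
    refine cauchySeq_of_le_tendsto_0 (fun n => (1 / 2 : ℝ) ^ n) (fun n m N hn hm => ?_)
      (tendsto_pow_atTop_nhds_zero_of_lt_one (by norm_num) (by norm_num))
    exact hnextε N (U N) (res (N + 1) α) _ (hanti α (Nat.succ_le_succ hn) (hpU (n + 1) α)) _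
      (hanti α (Nat.succ_le_succ hm) (hpU (m + 1) α))
  choose z hz using fun α => cauchySeq_tendsto_of_complete (hcau α)
  have hzU : ∀ α n, z α ∈ (U n).1 (res n α) := fun α n =>
    hclos n α <| mem_closure_of_tendsto (hz α) <| eventually_atTop.2
      ⟨n, fun m hm => hanti α (Nat.succ_le_succ hm) (hpU (m + 1) α)⟩
  -- Every branch has the same image `x n` at level `n`.
  have hzf : ∀ α β, f (z α) = f (z β) := fun α β => by
    have h : ∀ γ, Tendsto (fun n => x (n + 1)) atTop (𝓝 (f (z γ))) := fun γ => by
      simpa only [Function.comp_def, hpx] using (hf.tendsto (z γ)).comp (hz γ)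
    exact tendsto_nhds_unique (h α) (h β)
  have hzi : Function.Injective z := fun α β hαβ => by
    have key : ∀ n, res n α = res n β := fun n => by
      induction n with
      | zero => exact Subsingleton.elim _ _
      | succ n ih =>
        rw [hres, hres, ih]
        have hα := hzU α (n + 1)
        have hβ := hzU β (n + 1)
        rw [hres, ih] at hα
        rw [hres, ← hαβ] at hβ
        have hd := Set.disjoint_left.1 (hnextd n (U n) (res n β))
        cases hb : α n <;> cases hb' : β n <;> rw [hb] at hα <;> rw [hb'] at hβ
        · exact (hd hα hβ).elim
        · exact (hd hβ hα).elim
    funext n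
    exact congrFun (key (n + 1)) (Fin.last n)
  have hcount : (range z).Countable :=
    (hc (f (z fun _ => false))).mono (range_subset_iff.2 fun α => hzf α _)
  have : Countable (ℕ → Bool) := by
    have := hcount.to_subtype
    exact (rangeFactorization_injective.2 hzi).countable
  obtain ⟨e, he⟩ := exists_surjective_nat (ℕ → Bool)
  obtain ⟨n, hn⟩ := he fun n => !e n n
  simpa using congrFun hn n

/-- The range of a measurable countable-to-one map between standard Borel spaces is measurable. -/
theorem measurableSet_range_of_countable_fibers {X Z : Type*} [MeasurableSpace X]
    [StandardBorelSpace X] [MeasurableSpace Z] [StandardBorelSpace Z] {f : Z → X}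
    (hf : Measurable f) (hc : ∀ x, (f ⁻¹' {x}).Countable) : MeasurableSet (range f) := by
  let := upgradeStandardBorel X
  let := upgradeStandardBorel Z
  -- A finer Polish topology on `Z` makes `f` continuous.
  obtain ⟨t, -, hft, ht⟩ := hf.exists_continuous
  exact @measurableSet_range_of_continuous_of_countable_fibers X Z _ _ _ _ t ht f hft hc

/-- The projection of a Borel set with countable sections is Borel (Lusin–Novikov). -/
theorem measurableSet_image_fst_of_countable_sections {X Y : Type*} [MeasurableSpace X]
    [StandardBorelSpace X] [MeasurableSpace Y] [StandardBorelSpace Y] {R : Set (X × Y)}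
    (hR : MeasurableSet R) (hc : ∀ x, {y | (x, y) ∈ R}.Countable) :
    MeasurableSet {x | ∃ y, (x, y) ∈ R} := by
  have := hR.standardBorel
  convert measurableSet_range_of_countable_fibers (f := fun p : R => p.1.1) (by fun_prop) ?_
  · ext x; simp
  · intro x
    have : InjOn (fun p : R => p.1.2) ((fun p : R => p.1.1) ⁻¹' {x}) := fun p hp q hq h =>
      Subtype.ext (Prod.ext (Eq.trans hp (Eq.symm hq)) h)
    refine countable_of_injective_of_countable_image this ((hc x).mono ?_)
    rintro _ ⟨⟨⟨a, b⟩, hab⟩, rfl, rfl⟩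
    exact hab

end MeasureTheory

/-! ### Transfer to quotient Borel spaces -/

namespace QuotientBorelSpace

open Set

theorem isBorelRel_iff {X Y : Type*} [MeasurableSpace X] [StandardBorelSpace X]
    [MeasurableSpace Y] [StandardBorelSpace Y] {P : QuotientBorelSpace X}
    {Q : QuotientBorelSpace Y} {R : Set (P.Points × Q.Points)} :
    P.IsBorelRel Q R ↔ MeasurableSet {p : X × Y | (P.proj p.1, Q.proj p.2) ∈ R} := by
  have : (P.prod Q).proj ⁻¹' (P.prodPoints Q '' R) =
      {p : X × Y | (P.proj p.1, Q.proj p.2) ∈ R} := by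
    ext p
    exact (P.prodPoints Q).injective.mem_set_image (a := (P.proj p.1, Q.proj p.2))
  rw [IsBorelRel, IsBorel, this]

theorem countable_proj_preimage {X : Type*} [MeasurableSpace X] [StandardBorelSpace X]
    (P : QuotientBorelSpace X) {A : Set P.Points} (hA : A.Countable) :
    (P.proj ⁻¹' A).Countable := by
  rw [← biUnion_preimage_singleton]
  refine hA.biUnion fun a _ => ?_
  obtain ⟨x, rfl⟩ := Quotient.exists_rep a
  exact (P.countable_class x).mono fun y hy => P.rel.symm (Quotient.exact hy)

theorem IsBorelRel.isBorel_dom {X Y : Type*} [MeasurableSpace X] [StandardBorelSpace X]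
    [MeasurableSpace Y] [StandardBorelSpace Y] {P : QuotientBorelSpace X}
    {Q : QuotientBorelSpace Y} {R : Set (P.Points × Q.Points)} (hR : P.IsBorelRel Q R)
    (hc : ∀ x : P.Points, {y : Q.Points | (x, y) ∈ R}.Countable) :
    P.IsBorel {x : P.Points | ∃ y : Q.Points, (x, y) ∈ R} := by
  have h := MeasureTheory.measurableSet_image_fst_of_countable_sections (isBorelRel_iff.1 hR)
    fun x => Q.countable_proj_preimage (hc (P.proj x))
  have heq : P.proj ⁻¹' {x : P.Points | ∃ y : Q.Points, (x, y) ∈ R} =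
      {x | ∃ y, (x, y) ∈ {p : X × Y | (P.proj p.1, Q.proj p.2) ∈ R}} := by
    ext x
    exact Quotient.exists
  rw [IsBorel, heq]
  exact h

end QuotientBorelSpace

theorem mainTheorem9 {X Y : Type*} [MeasurableSpace X] [StandardBorelSpace X]
    [MeasurableSpace Y] [StandardBorelSpace Y]
    (P : QuotientBorelSpace X) (Q : QuotientBorelSpace Y) :
    (∀ R : Set (P.Points × Q.Points), P.IsBorelRel Q R →
      (∀ x : P.Points, {y : Q.Points | (x, y) ∈ R}.Countable) →
        P.IsBorel {x : P.Points | ∃ y : Q.Points, (x, y) ∈ R}) ∧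
    (∀ f : P.Points → Q.Points, P.IsBorelFun Q f →
      ∀ B : Set Q.Points, Q.IsBorel B → P.IsBorel (f ⁻¹' B)) ∧
    (∀ f : P.Points → Q.Points, P.IsBorelFun Q f →
      (∀ y : Q.Points, (f ⁻¹' {y}).Countable) →
        ∀ A : Set P.Points, P.IsBorel A → Q.IsBorel (f '' A)) := by
  refine ⟨fun R hR hc => hR.isBorel_dom hc, fun f hf B hB => ?_, fun f hf hc A hA => ?_⟩
  -- The preimage is the domain of this relation, whose sections have at most one point.
  · have hR : P.IsBorelRel Q {p | f p.1 = p.2 ∧ p.2 ∈ B} :=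
      QuotientBorelSpace.isBorelRel_iff.2
        ((QuotientBorelSpace.isBorelRel_iff.1 hf).inter (measurable_snd hB))
    convert hR.isBorel_dom fun x =>
      (Set.countable_singleton (f x)).mono fun y hy => Eq.symm hy.1 using 1
    ext x
    simp
  -- The image is the domain of the transposed graph restricted to `A`, whose sections lie in fibers
  -- of `f`.
  · have hR : Q.IsBorelRel P {p | f p.2 = p.1 ∧ p.2 ∈ A} :=
      QuotientBorelSpace.isBorelRel_iff.2
        ((measurable_swap (QuotientBorelSpace.isBorelRel_iff.1 hf)).inter (measurable_snd hA))
    convert hR.isBorel_dom fun y => (hc y).mono fun x hx => hx.1 using 1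
    ext y
    simp [and_comm]
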